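/- For real $\ell_-,\ell_+\ge 1$ and $c\in\mathbb R$ let $f_c=f_{c,\ell_-,\ell_+}:\mathbb R\to\mathbb R$ be given by $f_c(x)=|x|^{\ell_-}+c$ for $x\le 0$ and $f_c(x)=|x|^{\ell_+}+c$ for $x\ge 0$. The kneading sequence of $f_c$ is the sequence $i_1i_2\cdots\in\{-1,0,1\}^{\mathbb Z^+}$ in which $i_k$ is the sign of $f_c^k(0)$, where $f_c^k$ denotes the $k$-th iterate. For every integer $L\ge 1$ there exists a real number $\ell_0>1$ with the following property. Let $q\ge 1$ be an integer and let $\mathbf i=i_1i_2\cdots\in\{-1,0,1\}^{\mathbb Z^+}$ be a sequence such that $i_{k+q}=i_k$ for all $k\ge 1$, such that the symbol $0$ occurs in $\mathbf i$ (so that the critical point $0$ of any $f_c$ with kneading sequence $\mathbf i$ is periodic), and such that $$\#\{1\le j<q:\ i_j=-1\}\le L .$$ Let $\ell_-,\ell_+\ge \ell_0$ be real numbers. Then there is at most one $c\in\mathbb R$ for which the kneading sequence of $f_c$ equals $\mathbf i$. Moreover, if such a $c=c_*$ exists and $q$ is the minimal period of $\mathbf i$, then $Df_{c_*}^n(c_*)$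 exists and is nonzero for $0\le n<q$, and positive transversality holds: $$\sum_{n=0}^{q-1}\frac{1}{Df_{c_*}^n(c_*)}>0\qquad\text{and}\qquad \frac{\frac{d}{dc}f_c^q(0)\big|_{c=c_*}}{Df_{c_*}^{q-1}(c_*)}>0 ,$$ where $Df_{c_*}^n$ is the derivative in $x$ of the $n$-th iterate. -/

import Mathlib

/-- The asymmetric unimodal family: `|x| ^ lm + c` for `x ≤ 0` and `|x| ^ lp + c` for `x ≥ 0`
(for positive exponents the two branches agree at `0`). -/
noncomputable def asymFamily (lm lp c : ℝ) (x : ℝ) : ℝ :=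
  if x ≤ 0 then |x| ^ lm + c else |x| ^ lp + c

/-- The Milnor-Thurston kneading sequence `i₁ i₂ …` of a map `f` with turning point `0`:
`iₖ ∈ {-1, 0, 1}` is the sign of `f^k(0)`, `k ≥ 1`. -/
noncomputable def kneadingSeq (f : ℝ → ℝ) : ℕ+ → SignType :=
  fun k => SignType.sign (f^[(k : ℕ)] 0)

/-! Transversality. Let `x k` be the `k`-th critical iterate, returning to `0` first at time `q`,
and let `W(ρ) = ∑_{n<q} ρ^n / Df^n(c)`. Since `W(0) = 1`, a value `W(1) ≤ 0` forces a zero `ρ ∈ [0,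
1]`. The tail sums at that `ρ` give a vector with `v 1 = 1` and `v k = ρ (v (k+1) - v 1) / Df(x k)`:
an eigenvector of the linearised pull-back with eigenvalue `ρ⁻¹ ≥ 1`.

Steep branches exclude this. Let `M` be the largest absolute slope of `v` between two orbit points.
Across `0` slopes are at most `M / l₀`. On one side of `0`, the slope at a pair is a divided
difference through an inverse branch `u ↦ u^(1/ℓ)`. It is small once the slope at the image pair and
the slope from one of the two images to `x 1` are small (`exists_powerStep`). Induct on the time
until `0` separates the pair. Along runs of positive points the losses form a geometric series, so
constants deteriorate only at pairs of negative points. There are at most `L²` of these, hence a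
finite ladder of thresholds suffices: all slopes are at most `M / 2`, and `M = 0`.

Uniqueness. Pull `0` back along the branches prescribed by the kneading sequence; parameters
realising it are zeros of `criticalPullback - c`. At a zero the derivative is minus the
transversality sum, hence negative. So zeros are crossed downwards only, the domains of definition
are intervals by induction, and there is at most one zero. -/

/-! ### Divided differences through power maps of small exponent -/

/-- With `r = a / b`, the weights are `p = α (1 - r) / (1 - r^α)` and `s = p r^α / r`; Bernoulli's
inequality and `r ≤ r^α` give `α ≤ p ≤ 1`. Two forms are needed: the one based at `A` is useful when
`A` is small or `b / a` is huge, the one based at `B` when `B` is small and `b / a` is bounded. -/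
theorem rpow_dividedDifference {α a b R A B : ℝ} (hα : 0 < α) (hα1 : α ≤ 1) (ha : 0 < a)
    (hab : a < b) (hR : (b - a) * R = b * B - a * A) :
    ∃ p s : ℝ, α ≤ p ∧ p ≤ 1 ∧ p * Real.log (b / a) ≤ 1 + α * Real.log (b / a) ∧
      0 ≤ s ∧ s ≤ b / a ∧
      α * (b ^ α * B - a ^ α * A) / (b ^ α - a ^ α) = α * A + p * (R - A) ∧
      α * (b ^ α * B - a ^ α * A) / (b ^ α - a ^ α) = α * B + s * (R - B) := by
  have hb : 0 < b := ha.trans hab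
  have hr0 : 0 < a / b := by positivity
  have hr1 : a / b < 1 := by rwa [div_lt_one hb]
  set r := a / b with hr
  have har : a = r * b := by rw [hr]; field_simp
  have hb' : 0 < b ^ α := Real.rpow_pos_of_pos hb α
  have hy0 : 0 < r ^ α := Real.rpow_pos_of_pos hr0 α
  have hy1 : r ^ α < 1 := Real.rpow_lt_one hr0.le hr1 hα
  have hay : a ^ α = r ^ α * b ^ α := by rw [har, Real.mul_rpow hr0.le hb.le]
  have hlog : Real.log (b / a) = -Real.log r := by rw [hr, ← Real.log_inv, inv_div]
  have hbern : r ^ α ≤ 1 + α * (r - 1) := by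
    have := rpow_one_add_le_one_add_mul_self (s := r - 1) (by linarith) hα.le hα1
    simpa using this
  have hryα : r ≤ r ^ α := by
    have := Real.rpow_le_rpow_of_exponent_ge hr0 hr1.le hα1
    simpa using this
  set y := r ^ α with hy
  have hRB : R * (1 - r) = B - r * A := by
    rw [har] at hR
    have : b * (R * (1 - r)) = b * (B - r * A) := by linarith
    exact mul_left_cancel₀ hb.ne' this
  have hd : b ^ α - a ^ α = b ^ α * (1 - y) := by rw [hay]; ring
  have hp1 : α * (1 - r) / (1 - y) ≤ 1 := by
    rw [div_le_one (by linarith)]; linarith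
  have hp0 : α ≤ α * (1 - r) / (1 - y) := by
    rw [le_div_iff₀ (by linarith)]; nlinarith
  refine ⟨α * (1 - r) / (1 - y), α * (1 - r) / (1 - y) * (y / r), hp0, hp1, ?_, ?_, ?_, ?_, ?_⟩
  · set t := Real.log (b / a) with ht
    have ht0 : 0 < t := Real.log_pos (by rw [one_lt_div ha]; exact hab)
    have hyt : y = Real.exp (-(α * t)) := by
      rw [hy, Real.rpow_def_of_pos hr0, hlog]; congr 1; ring
    have hx : 0 < α * t := by positivity
    have h1 : 1 + α * t ≤ Real.exp (α * t) := by linarith [Real.add_one_le_exp (α * t)]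
    have h2 : y * (1 + α * t) ≤ 1 := by
      have : y * Real.exp (α * t) = 1 := by rw [hyt, ← Real.exp_add]; simp
      nlinarith
    rw [div_mul_eq_mul_div, div_le_iff₀ (by linarith)]
    nlinarith [mul_pos hx hr0]
  · have : 0 ≤ α * (1 - r) / (1 - y) := hα.le.trans hp0
    positivity
  · have h1 : b / a = 1 / r := by rw [hr]; field_simp
    rw [h1]
    have : y / r ≤ 1 / r := by gcongr
    calc _ ≤ 1 * (y / r) := by gcongr
      _ ≤ 1 / r := by rwa [one_mul]
  · have hB : B = R * (1 - r) + r * A := by linarith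
    rw [hd, hay, hB]
    have : 1 - y ≠ 0 := by linarith
    field_simp
    ring
  · have hA : A = (B - R * (1 - r)) / r := by field_simp; linarith
    rw [hd, hay, hA]
    have : 1 - y ≠ 0 := by linarith
    field_simp
    ring

/-- Smallness of the divided difference `R` and of one of the end values propagates through the
power map of small exponent. -/
def PowerStep (ξ ε : ℝ) : Prop :=
  ∀ α a b R A B M : ℝ, 0 < α → α ≤ ξ → 0 < a → a < b → (b - a) * R = b * B - a * A →
    |R| ≤ M → |A| ≤ M → |B| ≤ M → |R| ≤ ξ * M → (|A| ≤ ξ * M ∨ |B| ≤ ξ * M) →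
    |α * (b ^ α * B - a ^ α * A) / (b ^ α - a ^ α)| ≤ ε * M

theorem PowerStep.mono {ξ ξ' ε ε' : ℝ} (h : PowerStep ξ ε) (hξ : ξ' ≤ ξ) (hε : ε ≤ ε') :
    PowerStep ξ' ε' := by
  intro α a b R A B M hα hα' ha hab hR hRM hA hB hRξ hAB
  have hM : 0 ≤ M := (abs_nonneg R).trans hRM
  have h1 : ξ' * M ≤ ξ * M := by gcongr
  refine (h α a b R A B M hα (hα'.trans hξ) ha hab hR hRM hA hB (hRξ.trans h1)
    (hAB.imp (·.trans h1) (·.trans h1))).trans (by gcongr)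

theorem exists_powerStep {ε : ℝ} (hε : 0 < ε) : ∃ ξ, 0 < ξ ∧ ξ ≤ ε ∧ ξ ≤ 1 ∧ PowerStep ξ ε := by
  wlog hε1 : ε ≤ 1 generalizing ε
  · obtain ⟨ξ, h1, h2, h3, h4⟩ := this one_pos le_rfl
    exact ⟨ξ, h1, h2.trans (not_le.1 hε1).le, h3, h4.mono le_rfl (not_le.1 hε1).le⟩
  -- `K` splits the case where only `B` is known to be small: for `b / a ≤ K` the weight `s ≤ K` is
  -- absorbed by `ξ = ε / (8 K)`, and for `b / a ≥ K` the bound `p ≤ α + 1 / log (b / a) ≤ ε / 4`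
  -- makes smallness of `A` unnecessary.
  set K := Real.exp (8 / ε) with hK
  have hK1 : 1 ≤ K := Real.one_le_exp (by positivity)
  have hξK : ε / (8 * K) * K = ε / 8 := by field_simp
  have hξ8 : ε / (8 * K) ≤ ε / 8 := by
    rw [← hξK]; exact le_mul_of_one_le_right (by positivity) hK1
  refine ⟨ε / (8 * K), by positivity, by linarith, by linarith, ?_⟩
  generalize ε / (8 * K) = ξ at hξK hξ8
  intro α a b R A B M hα hα' ha hab hR hRM hA hB hRξ hAB
  have hM : 0 ≤ M := (abs_nonneg R).trans hRM
  obtain ⟨p, s, hp0, hp1, hpl, hs0, hs1, h1, h2⟩ :=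
    rpow_dividedDifference hα (by linarith) ha hab hR
  have hp : 0 ≤ p := hα.le.trans hp0
  have hξM : ξ * M ≤ ε / 8 * M := by gcongr
  have hεM : 0 ≤ ε * M := by positivity
  have key1 : |α * A + p * (R - A)| ≤ α * |A| + p * (|R| + |A|) := by
    refine (abs_add_le _ _).trans ?_
    rw [abs_mul, abs_mul, abs_of_pos hα, abs_of_nonneg hp]
    gcongr
    exact abs_sub _ _
  have key2 : |α * B + s * (R - B)| ≤ α * |B| + s * (|R| + |B|) := by
    refine (abs_add_le _ _).trans ?_
    rw [abs_mul, abs_mul, abs_of_pos hα, abs_of_nonneg hs0]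
    gcongr
    exact abs_sub _ _
  rcases hAB with hA' | hB'
  · rw [h1]
    have e1 : α * |A| ≤ 1 * |A| := by gcongr; linarith
    have e2 : p * (|R| + |A|) ≤ 1 * (|R| + |A|) := by gcongr
    linarith
  · rcases le_total (b / a) K with hle | hle
    · rw [h2]
      have e1 : α * |B| ≤ 1 * |B| := by gcongr; linarith
      have e2 : s * (|R| + |B|) ≤ K * (ξ * M + ξ * M) := by
        gcongr
        exact hs1.trans hle
      have e3 : K * (ξ * M + ξ * M) = 2 * (ε / 8) * M := by rw [← hξK]; ring
      linarith
    · rw [h1]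
      have hl : 8 / ε ≤ Real.log (b / a) := by
        rw [← Real.log_exp (8 / ε)]; exact Real.log_le_log (Real.exp_pos _) hle
      have hp' : p ≤ ε / 4 := by
        have hl0 : 0 < Real.log (b / a) := lt_of_lt_of_le (by positivity) hl
        have h8 : 1 ≤ ε / 8 * Real.log (b / a) := by
          rw [div_le_iff₀ hε] at hl; linarith
        have : p * Real.log (b / a) ≤ ε / 4 * Real.log (b / a) := by nlinarith
        exact le_of_mul_le_mul_right this hl0
      have e1 : α * |A| ≤ ε / 8 * M := by gcongr; linarith
      have e2 : p * (|R| + |A|) ≤ ε / 4 * (M + M) := by gcongr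
      linarith

/-- A finite ladder of thresholds ending at `1 / 4`, each rung controlling the next. -/
theorem exists_powerStep_ladder (m : ℕ) :
    ∃ (a : ℝ) (g : ℕ → ℝ), 0 < a ∧ a ≤ 1 / 4 ∧ 2 * a ≤ g 0 ∧ PowerStep a (g 0) ∧ Monotone g ∧
      (∀ i < m, PowerStep (2 * g i) (g (i + 1))) ∧ g m ≤ 1 / 4 := by
  -- An arbitrary top value `ε` lets the induction add a rung at the top: the old ladder is built to
  -- end below `ξ / 2`, where `ξ` is the input threshold for output `ε`.
  suffices H : ∀ ε : ℝ, 0 < ε → ∃ g : ℕ → ℝ, 0 < g 0 ∧ Monotone g ∧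
      (∀ i < m, PowerStep (2 * g i) (g (i + 1))) ∧ g m ≤ ε by
    obtain ⟨g, h0, h1, h2, h3⟩ := H (1 / 4) (by norm_num)
    obtain ⟨ξ, k1, k2, k3, k4⟩ := exists_powerStep h0
    refine ⟨min (ξ / 2) (1 / 4), g, by positivity, min_le_right _ _, ?_, ?_, h1, h2, h3⟩
    · linarith [min_le_left (ξ / 2) (1 / 4)]
    · exact k4.mono ((min_le_left _ _).trans (by linarith)) le_rfl
  induction m with
  | zero => intro ε hε; exact ⟨fun _ => ε, hε, monotone_const, by simp, le_rfl⟩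
  | succ m ih =>
    intro ε hε
    obtain ⟨ξ, k1, k2, k3, k4⟩ := exists_powerStep hε
    obtain ⟨g, h0, h1, h2, h3⟩ := ih (ξ / 2) (by positivity)
    refine ⟨fun i => if i ≤ m then g i else ε, by simpa using h0, ?_, ?_, by simp⟩
    · intro i j hij
      dsimp only
      split_ifs with hi hj hj
      · exact h1 hij
      · linarith [h1 hi]
      · omega
      · exact le_rfl
    · intro i hi
      rcases Nat.lt_succ_iff_lt_or_eq.1 hi with h | rfl
      · simpa [h.le, Nat.succ_le_of_lt h] using h2 i h
      · simpa using k4.mono (by linarith) le_rfl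

/-! ### Order structure and separation times of a critical cycle -/

/-- The exponent of the branch of the family on which `y` lies. -/
noncomputable def sideExp (lm lp y : ℝ) : ℝ := if y ≤ 0 then lm else lp

theorem asymFamily_eq (lm lp c y : ℝ) : asymFamily lm lp c y = |y| ^ sideExp lm lp y + c := by
  unfold asymFamily sideExp; split_ifs <;> rfl

/-- `x 1, …, x q` is a finite orbit of critical values that returns to the turning point
for the first time at time `q`. -/
structure CriticalCycle (lm lp : ℝ) (q : ℕ) (x : ℕ → ℝ) : Prop where
  lm_pos : 0 < lm
  lp_pos : 0 < lp
  two_le : 2 ≤ q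
  last : x q = 0
  ne_zero : ∀ k, 1 ≤ k → k < q → x k ≠ 0
  step : ∀ k, 1 ≤ k → k < q → x (k + 1) = |x k| ^ sideExp lm lp (x k) + x 1

theorem sideExp_pos {lm lp : ℝ} (hm : 0 < lm) (hp : 0 < lp) (y : ℝ) : 0 < sideExp lm lp y := by
  unfold sideExp; split_ifs <;> assumption

theorem le_sideExp {l lm lp : ℝ} (hm : l ≤ lm) (hp : l ≤ lp) (y : ℝ) : l ≤ sideExp lm lp y := by
  unfold sideExp; split_ifs <;> assumption

theorem sideExp_congr {lm lp y z : ℝ} (h : 0 < y * z) : sideExp lm lp y = sideExp lm lp z := by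
  unfold sideExp
  rcases pos_and_pos_or_neg_and_neg_of_mul_pos h with ⟨h1, h2⟩ | ⟨h1, h2⟩
  · rw [if_neg (not_le.2 h1), if_neg (not_le.2 h2)]
  · rw [if_pos h1.le, if_pos h2.le]

/-- The time until the orbits of the points with indices `j` and `k` are separated by `0`. -/
noncomputable def separationTime (x : ℕ → ℝ) (j k : ℕ) : ℕ := sInf {t | x (j + t) * x (k + t) ≤ 0}

theorem mul_pos_of_lt_separationTime {x : ℕ → ℝ} {j k t : ℕ} (h : t < separationTime x j k) :
    0 < x (j + t) * x (k + t) :=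
  not_le.1 fun h' => Nat.notMem_of_lt_sInf h h'

theorem separationTime_le {x : ℕ → ℝ} {j k t : ℕ} (h : x (j + t) * x (k + t) ≤ 0) :
    separationTime x j k ≤ t := Nat.sInf_le h

/-- The slope of a function `v` on the points `x` between two indices. -/
noncomputable def slopeBetween (x v : ℕ → ℝ) (j k : ℕ) : ℝ := (v j - v k) / (x j - x k)

theorem slopeBetween_comm (x v : ℕ → ℝ) (j k : ℕ) :
    slopeBetween x v j k = slopeBetween x v k j := by
  unfold slopeBetween; rw [← neg_sub (v k), ← neg_sub (x k), neg_div_neg_eq]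

namespace CriticalCycle

variable {lm lp : ℝ} {q : ℕ} {x : ℕ → ℝ}

theorem first_lt (h : CriticalCycle lm lp q x) {k : ℕ} (h1 : 1 ≤ k) (hk : k < q) :
    x 1 < x (k + 1) := by
  rw [h.step k h1 hk]
  have := Real.rpow_pos_of_pos (abs_pos.2 (h.ne_zero k h1 hk)) (sideExp lm lp (x k))
  linarith

theorem first_neg (h : CriticalCycle lm lp q x) : x 1 < 0 := by
  have h2 := h.two_le
  have := h.first_lt (k := q - 1) (by omega) (by omega)
  rwa [Nat.sub_add_cancel (by omega), h.last] at this

theorem first_le (h : CriticalCycle lm lp q x) {k : ℕ} (h1 : 1 ≤ k) (hk : k ≤ q) : x 1 ≤ x k := by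
  rcases h1.eq_or_lt with rfl | h1
  · exact le_rfl
  · obtain ⟨k, rfl⟩ : ∃ m, k = m + 1 := ⟨k - 1, by omega⟩
    exact (h.first_lt (by omega) hk).le

theorem lt_of_ne_zero (h : CriticalCycle lm lp q x) {k : ℕ} (hk : k ≤ q) (h0 : x k ≠ 0) :
    k < q := lt_of_le_of_ne hk fun e => h0 (e ▸ h.last)

theorem eq_add_of_eq (h : CriticalCycle lm lp q x) {j k : ℕ} (hj : 1 ≤ j) (hjk : j < k)
    (e : x j = x k) : ∀ t, k + t ≤ q → x (j + t) = x (k + t) := by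
  intro t
  induction t with
  | zero => intro _; exact e
  | succ t ih =>
    intro ht
    rw [← add_assoc, ← add_assoc, h.step (j + t) (by omega) (by omega),
      h.step (k + t) (by omega) (by omega), ih (by omega)]

theorem injOn (h : CriticalCycle lm lp q x) {j k : ℕ} (hj : 1 ≤ j) (hjq : j ≤ q) (hk : 1 ≤ k)
    (hkq : k ≤ q) (hne : j ≠ k) : x j ≠ x k := by
  wlog hjk : j < k generalizing j k
  · exact (this hk hkq hj hjq hne.symm (by omega)).symm
  intro e
  have := h.eq_add_of_eq hj hjk e (q - k) (by omega)
  rw [Nat.add_sub_cancel' hkq, h.last] at this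
  exact h.ne_zero _ (by omega) (by omega) this

/-- If `x 2 < 0`, the orbit is trapped in `[x 1, x 2]`, where the map is decreasing, and never
returns to `0`. -/
theorem second_nonneg (h : CriticalCycle lm lp q x) : 0 ≤ x 2 := by
  by_contra! h2
  have hq := h.two_le
  have key : ∀ k, k + 1 ≤ q → x (k + 1) ≤ x 2 := by
    intro k
    induction k with
    | zero => intro _; exact h.first_le (by omega) hq
    | succ k ih =>
      intro hk
      have i1 := ih (by omega)
      have i2 := h.first_le (k := k + 1) (by omega) (by omega)
      have i3 := h.first_neg
      rw [h.step (k + 1) (by omega) (by omega), h.step 1 le_rfl (by omega),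
        sideExp_congr (z := x 1) (mul_pos_of_neg_of_neg (by linarith) i3)]
      have : |x (k + 1)| ≤ |x 1| := by
        rw [abs_of_neg i3, abs_of_neg (by linarith)]; linarith
      gcongr
      exact (sideExp_pos h.lm_pos h.lp_pos _).le
  have := key (q - 1) (by omega)
  rw [Nat.sub_add_cancel (by omega), h.last] at this
  linarith

theorem step_pos (h : CriticalCycle lm lp q x) {k : ℕ} (h1 : 1 ≤ k) (hk : k < q) (h0 : 0 < x k) :
    x (k + 1) = x k ^ lp + x 1 := by
  rw [h.step k h1 hk, sideExp, if_neg (not_le.2 h0), abs_of_pos h0]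

/-- A larger maximum `x m` has no possible predecessor: a negative one lies in `[x 1, 0)`, so its
image is at most `x 2`; a positive one is below `x m`, and monotonicity of the right branch then
gives `x (m+1) > x m`. -/
theorem le_second (h : CriticalCycle lm lp q x) {k : ℕ} (h1 : 1 ≤ k) (hk : k ≤ q) :
    x k ≤ x 2 := by
  have hq := h.two_le
  obtain ⟨m, hm, hmax⟩ := Finset.exists_max_image (Finset.Icc 1 q) x ⟨1, by simp; omega⟩
  rw [Finset.mem_Icc] at hm
  refine (hmax k (Finset.mem_Icc.2 ⟨h1, hk⟩)).trans ?_
  by_contra! hlt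
  have hmpos : 0 < x m := h.second_nonneg.trans_lt hlt
  have hmq : m < q := h.lt_of_ne_zero hm.2 hmpos.ne'
  have hm1 : m ≠ 1 := by rintro rfl; linarith [h.first_neg]
  have hm2 : m ≠ 2 := by rintro rfl; linarith
  obtain ⟨n, rfl⟩ : ∃ n, m = n + 1 := ⟨m - 1, by omega⟩
  rcases (h.ne_zero n (by omega) (by omega)).lt_or_gt with hn | hn
  · have i2 := h.first_le (k := n) (by omega) (by omega)
    have i3 := h.first_neg
    rw [h.step n (by omega) (by omega), h.step 1 le_rfl (by omega),
      sideExp_congr (z := x 1) (mul_pos_of_neg_of_neg hn i3)] at hlt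
    have : |x n| ≤ |x 1| := by
      rw [abs_of_neg i3, abs_of_neg hn]; linarith
    have := Real.rpow_le_rpow (abs_nonneg _) this (sideExp_pos h.lm_pos h.lp_pos (x 1)).le
    linarith
  · have i1 := hmax n (Finset.mem_Icc.2 ⟨by omega, by omega⟩)
    have i2 := hmax (n + 1 + 1) (Finset.mem_Icc.2 ⟨by omega, by omega⟩)
    have e1 := h.step_pos (by omega) (by omega) hn
    have e2 := h.step_pos (by omega) hmq hmpos
    have i3 : x n < x (n + 1) :=
      lt_of_le_of_ne i1 (h.injOn (by omega) (by omega) (by omega) (by omega) (by omega))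
    have := Real.rpow_lt_rpow hn.le i3 h.lp_pos
    linarith

theorem le_second_add (h : CriticalCycle lm lp q x) {b : ℕ} (hb : 1 ≤ b) :
    ∀ n, b + n ≤ q → 2 + n ≤ q → (∀ s < n, 0 < x (b + s)) → x (b + n) ≤ x (2 + n) := by
  intro n
  induction n with
  | zero => intro h1 _ _; exact h.le_second hb h1
  | succ n ih =>
    intro h1 h2 hs
    have i1 := ih (by omega) (by omega) fun s hs' => hs s (by omega)
    have i2 := hs n (by omega)
    rw [← add_assoc, ← add_assoc, h.step_pos (by omega) (by omega) i2,
      h.step_pos (by omega) (by omega) (i2.trans_le i1)]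
    have := h.lp_pos
    gcongr

theorem separationTime_spec (h : CriticalCycle lm lp q x) {j k : ℕ} (hjq : j ≤ q) (hkq : k ≤ q) :
    x (j + separationTime x j k) * x (k + separationTime x j k) ≤ 0 ∧
      j + separationTime x j k ≤ q ∧ k + separationTime x j k ≤ q := by
  have key : ∀ t, t = q - max j k → x (j + t) * x (k + t) ≤ 0 := by
    rintro t rfl
    rcases le_total j k with hjk | hjk
    · rw [max_eq_right hjk, Nat.add_sub_cancel' hkq, h.last, mul_zero]
    · rw [max_eq_left hjk, Nat.add_sub_cancel' hjq, h.last, zero_mul]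
  have h1 := separationTime_le (key _ rfl)
  refine ⟨Nat.sInf_mem (s := {t | x (j + t) * x (k + t) ≤ 0}) ⟨_, key _ rfl⟩, ?_, ?_⟩ <;>
    omega

theorem separationTime_add (h : CriticalCycle lm lp q x) {j k s : ℕ} (hjq : j ≤ q) (hkq : k ≤ q)
    (hs : s ≤ separationTime x j k) :
    separationTime x (j + s) (k + s) = separationTime x j k - s := by
  obtain ⟨h1, h2, h3⟩ := h.separationTime_spec hjq hkq
  apply le_antisymm
  · apply separationTime_le
    rwa [add_assoc, add_assoc, Nat.add_sub_cancel' hs]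
  · obtain ⟨h4, -, -⟩ := h.separationTime_spec (j := j + s) (k := k + s) (by omega) (by omega)
    rw [add_assoc, add_assoc] at h4
    have := separationTime_le h4
    omega

/-- Ultrametric property: if `b` and `c` both still shared the sign of the orbit of `1` at the time
they separate, they would share it with each other. It supplies the one-sided alternative required
by `PowerStep`. -/
theorem separationTime_first_le (h : CriticalCycle lm lp q x) {b c : ℕ} (hb : b ≤ q) (hc : c ≤ q) :
    separationTime x b 1 ≤ separationTime x b c ∨ separationTime x c 1 ≤ separationTime x b c := by
  by_contra! H
  have h1 := mul_pos_of_lt_separationTime H.1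
  have h2 := mul_pos_of_lt_separationTime H.2
  have h3 := (h.separationTime_spec hb hc).1
  set m := separationTime x b c
  have h4 : 0 < (x (b + m) * x (c + m)) * (x (1 + m)) ^ 2 := by nlinarith [mul_pos h1 h2]
  nlinarith [sq_nonneg (x (1 + m))]

end CriticalCycle

/-! ### Slope estimates for eigenvectors of the linearised pull-back -/

/-- `v` is an eigenvector of the linearised pull-back along the cycle `x`, with eigenvalue
`ρ⁻¹ ≥ 1`. -/
structure PullbackEigenvector (lm lp ρ : ℝ) (q : ℕ) (x v : ℕ → ℝ) : Prop where
  nonneg : 0 ≤ ρ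
  le_one : ρ ≤ 1
  last : v q = 0
  pull : ∀ k, 1 ≤ k → k < q →
    v k = ρ * ((sideExp lm lp (x k))⁻¹ * x k * slopeBetween x v (k + 1) 1)

namespace PullbackEigenvector

variable {lm lp ρ a M : ℝ} {q : ℕ} {x v : ℕ → ℝ}

theorem abs_le (hv : PullbackEigenvector lm lp ρ q x v) (ha : 0 < a) (hm : a⁻¹ ≤ lm) (hp : a⁻¹ ≤ lp)
    {k : ℕ} (h1 : 1 ≤ k) (hk : k < q) : |v k| ≤ a * |slopeBetween x v (k + 1) 1| * |x k| := by
  have hE := le_sideExp hm hp (x k)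
  have hE0 : 0 < sideExp lm lp (x k) := lt_of_lt_of_le (by positivity) hE
  have hEa : (sideExp lm lp (x k))⁻¹ ≤ a := by
    rw [inv_le_comm₀ hE0 ha]; exact hE
  rw [hv.pull k h1 hk, abs_mul, abs_mul, abs_mul, abs_of_nonneg hv.nonneg,
    abs_of_pos (inv_pos.2 hE0)]
  calc ρ * ((sideExp lm lp (x k))⁻¹ * |x k| * |slopeBetween x v (k + 1) 1|)
      ≤ 1 * (a * |x k| * |slopeBetween x v (k + 1) 1|) := by
        gcongr
        exact hv.le_one
    _ = _ := by ring

/-- Across `0` one has `|x j - x k| = |x j| + |x k|`, so the bounds relative to `0` add without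
loss. -/
theorem abs_slope_le_of_mul_nonpos {T : ℝ} {j k : ℕ} (hT : 0 ≤ T) (hj : |v j| ≤ T * |x j|)
    (hk : |v k| ≤ T * |x k|) (hjk : x j * x k ≤ 0) : |slopeBetween x v j k| ≤ T := by
  rw [slopeBetween, abs_div]
  refine div_le_of_le_mul₀ (abs_nonneg _) hT ?_
  have : |x j - x k| = |x j| + |x k| := by
    rcases mul_nonpos_iff.1 hjk with ⟨h1, h2⟩ | ⟨h1, h2⟩
    · rw [abs_of_nonneg h1, abs_of_nonpos h2, abs_of_nonneg (by linarith)]; ring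
    · rw [abs_of_nonneg h2, abs_of_nonpos h1, abs_of_nonpos (by linarith)]; ring
  rw [this, mul_add]
  exact (abs_sub _ _).trans (add_le_add hj hk)

theorem abs_slope_le_of_separated (hv : PullbackEigenvector lm lp ρ q x v)
    (ha : 0 < a) (hm : a⁻¹ ≤ lm) (hp : a⁻¹ ≤ lp)
    (hM : ∀ j k, 1 ≤ j → j ≤ q → 1 ≤ k → k ≤ q → |slopeBetween x v j k| ≤ M)
    {j k : ℕ} (hj : 1 ≤ j) (hjq : j ≤ q) (hk : 1 ≤ k) (hkq : k ≤ q) (hjk : x j * x k ≤ 0) :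
    |slopeBetween x v j k| ≤ a * M := by
  have hM0 : 0 ≤ M := (abs_nonneg _).trans (hM j k hj hjq hk hkq)
  have key : ∀ i, 1 ≤ i → i ≤ q → |v i| ≤ a * M * |x i| := by
    intro i hi hiq
    rcases hiq.eq_or_lt with rfl | hiq
    · rw [hv.last, abs_zero]; positivity
    · refine (hv.abs_le ha hm hp hi hiq).trans ?_
      gcongr
      exact hM _ _ (by omega) (by omega) (by omega) (by omega)
  exact abs_slope_le_of_mul_nonpos (by positivity) (key j hj hjq) (key k hk hkq) hjk

/-- Each positive point gains a factor `a`, because it and `x 1 < 0` lie on opposite sides of `0`.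
This needs the bound at both images `b + 1` and `2`; the orbit of `x 2` stays positive as well,
since it dominates that of `x b` along the increasing branch. -/
theorem abs_slope_first_le_pow (h : CriticalCycle lm lp q x)
    (hv : PullbackEigenvector lm lp ρ q x v)
    (ha : 0 < a) (hm : a⁻¹ ≤ lm) (hp : a⁻¹ ≤ lp)
    (hM : ∀ j k, 1 ≤ j → j ≤ q → 1 ≤ k → k ≤ q → |slopeBetween x v j k| ≤ M) (n : ℕ) :
    ∀ b, 2 ≤ b → b + n ≤ q → (∀ s < n, 0 < x (b + s)) → |slopeBetween x v b 1| ≤ a ^ n * M := by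
  have hq := h.two_le
  have two : ∀ n b, 2 ≤ b → b + n ≤ q → (∀ s < n, 0 < x (b + s)) →
      2 + n ≤ q ∧ ∀ s < n, 0 < x (2 + s) := by
    intro n
    induction n with
    | zero => intro b _ _ _; exact ⟨hq, by simp⟩
    | succ n ih =>
      intro b hb hbn hs
      obtain ⟨i1, i2⟩ := ih b hb (by omega) fun s hs' => hs s (by omega)
      have i3 := (hs n (by omega)).trans_le
        (h.le_second_add (by omega) n (by omega) i1 fun s hs' => hs s (by omega))
      refine ⟨h.lt_of_ne_zero i1 i3.ne', fun s hs' => ?_⟩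
      rcases Nat.lt_succ_iff_lt_or_eq.1 hs' with h' | rfl
      · exact i2 s h'
      · exact i3
  induction n with
  | zero =>
    intro b hb hbn _
    simpa using hM b 1 (by omega) (by omega) le_rfl (by omega)
  | succ n ih =>
    intro b hb hbn hs
    obtain ⟨i1, i2⟩ := two (n + 1) b hb hbn hs
    have hM0 : 0 ≤ M := (abs_nonneg _).trans (hM 1 1 (by omega) (by omega) (by omega) (by omega))
    have j1 := ih (b + 1) (by omega) (by omega) fun s hs' => by
      simpa [add_assoc, add_comm 1 s] using hs (s + 1) (by omega)
    have j2 := ih 2 le_rfl (by omega) fun s hs' => i2 s (by omega)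
    have k1 := hv.abs_le ha hm hp (k := b) (by omega) (by omega)
    have k2 := hv.abs_le ha hm hp (k := 1) le_rfl (by omega)
    have hb0 : 0 < x b := by simpa using hs 0 (by omega)
    rw [pow_succ']
    refine abs_slope_le_of_mul_nonpos (by positivity) (k1.trans ?_) (k2.trans ?_)
      (mul_nonpos_of_nonneg_of_nonpos hb0.le h.first_neg.le)
    · rw [mul_assoc a (a ^ n)]; gcongr
    · rw [mul_assoc a (a ^ n)]; gcongr

/-- With `u = x (k+1) - x 1 = |x k|^ℓ`, both `x k` and `v k` are multiples of `u^(1/ℓ)`, and the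
common sign of `x j`, `x k` cancels. The result is the quotient of `rpow_dividedDifference`, with
the slope of the image pair as `R`. -/
theorem slope_eq (h : CriticalCycle lm lp q x) (hv : PullbackEigenvector lm lp ρ q x v)
    {j k : ℕ} (hj : 1 ≤ j) (hjq : j < q) (hk : 1 ≤ k) (hkq : k < q) (hjk : 0 < x j * x k) :
    slopeBetween x v j k = ρ * ((sideExp lm lp (x j))⁻¹ *
      ((x (j + 1) - x 1) ^ (sideExp lm lp (x j))⁻¹ * slopeBetween x v (j + 1) 1 -
        (x (k + 1) - x 1) ^ (sideExp lm lp (x j))⁻¹ * slopeBetween x v (k + 1) 1) /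
      ((x (j + 1) - x 1) ^ (sideExp lm lp (x j))⁻¹ -
        (x (k + 1) - x 1) ^ (sideExp lm lp (x j))⁻¹)) := by
  have hE := sideExp_congr (lm := lm) (lp := lp) hjk
  have hE0 := sideExp_pos h.lm_pos h.lp_pos (x j)
  have e1 : (x (j + 1) - x 1) ^ (sideExp lm lp (x j))⁻¹ = |x j| := by
    rw [h.step j hj hjq, add_sub_cancel_right, Real.rpow_rpow_inv (abs_nonneg _) hE0.ne']
  have e2 : (x (k + 1) - x 1) ^ (sideExp lm lp (x j))⁻¹ = |x k| := by
    rw [hE, h.step k hk hkq, add_sub_cancel_right, Real.rpow_rpow_inv (abs_nonneg _) (hE ▸ hE0.ne')]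
  rw [e1, e2]
  conv_lhs => rw [slopeBetween, hv.pull j hj hjq, hv.pull k hk hkq, ← hE]
  rcases pos_and_pos_or_neg_and_neg_of_mul_pos hjk with ⟨h1, h2⟩ | ⟨h1, h2⟩
  · rw [abs_of_pos h1, abs_of_pos h2]; ring
  · rw [abs_of_neg h1, abs_of_neg h2, ← neg_sub_neg (x k), ← neg_div_neg_eq]
    ring

theorem abs_slope_le_step (h : CriticalCycle lm lp q x) (hv : PullbackEigenvector lm lp ρ q x v)
    (ha : 0 < a) (hm : a⁻¹ ≤ lm) (hp : a⁻¹ ≤ lp)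
    (hM : ∀ j k, 1 ≤ j → j ≤ q → 1 ≤ k → k ≤ q → |slopeBetween x v j k| ≤ M)
    {ξ ε : ℝ} (hstep : PowerStep ξ ε) (haξ : a ≤ ξ)
    {j k : ℕ} (hj : 1 ≤ j) (hjq : j < q) (hk : 1 ≤ k) (hkq : k < q) (hne : j ≠ k)
    (hjk : 0 < x j * x k) (hR : |slopeBetween x v (j + 1) (k + 1)| ≤ ξ * M)
    (hP : |slopeBetween x v (j + 1) 1| ≤ ξ * M ∨ |slopeBetween x v (k + 1) 1| ≤ ξ * M) :
    |slopeBetween x v j k| ≤ ε * M := by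
  wlog hlt : x (k + 1) < x (j + 1) generalizing j k
  · have hne' := h.injOn (j := j + 1) (k := k + 1) (by omega) (by omega) (by omega) (by omega)
      (by omega)
    rw [slopeBetween_comm]
    rw [slopeBetween_comm] at hR
    exact this hk hkq hj hjq hne.symm (by rwa [mul_comm]) hR hP.symm
      (lt_of_le_of_ne (not_lt.1 hlt) hne')
  have u1 := h.first_lt hj hjq
  have u2 := h.first_lt hk hkq
  have hE := le_sideExp hm hp (x j)
  have hE0 : 0 < sideExp lm lp (x j) := lt_of_lt_of_le (by positivity) hE
  have hEa : (sideExp lm lp (x j))⁻¹ ≤ a := by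
    rw [inv_le_comm₀ hE0 ha]; exact hE
  have := hstep (sideExp lm lp (x j))⁻¹ (x (k + 1) - x 1) (x (j + 1) - x 1)
    (slopeBetween x v (j + 1) (k + 1)) (slopeBetween x v (k + 1) 1) (slopeBetween x v (j + 1) 1) M
    (by positivity) (hEa.trans haξ) (by linarith) (by linarith)
    (by
      have : x (j + 1) - x (k + 1) ≠ 0 := by linarith
      have : x (j + 1) - x 1 ≠ 0 := by linarith
      have : x (k + 1) - x 1 ≠ 0 := by linarith
      simp only [slopeBetween]
      field_simp
      ring)
    (hM _ _ (by omega) (by omega) (by omega) (by omega))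
    (hM _ _ (by omega) (by omega) (by omega) (by omega))
    (hM _ _ (by omega) (by omega) (by omega) (by omega)) hR hP.symm
  rw [slope_eq h hv hj hjq hk hkq hjk, abs_mul, abs_of_nonneg hv.nonneg]
  calc _ ≤ 1 * _ := mul_le_mul_of_nonneg_right hv.le_one (abs_nonneg _)
    _ ≤ _ := by rwa [one_mul]

/-- The quotient equals `p R - (p - α) A` with both coefficients in `[0, 1]`. Unlike
`abs_slope_le_step`, the term `R` is passed on with factor at most one and only `T` is lost. -/
theorem abs_slope_le_add (h : CriticalCycle lm lp q x) (hv : PullbackEigenvector lm lp ρ q x v)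
    (hm : 1 ≤ lm) (hp : 1 ≤ lp)
    {T : ℝ} {j k : ℕ} (hj : 1 ≤ j) (hjq : j < q) (hk : 1 ≤ k) (hkq : k < q) (hne : j ≠ k)
    (hjk : 0 < x j * x k)
    (hP : |slopeBetween x v (j + 1) 1| ≤ T ∧ |slopeBetween x v (k + 1) 1| ≤ T) :
    |slopeBetween x v j k| ≤ |slopeBetween x v (j + 1) (k + 1)| + T := by
  wlog hlt : x (k + 1) < x (j + 1) generalizing j k
  · have hne' := h.injOn (j := j + 1) (k := k + 1) (by omega) (by omega) (by omega) (by omega)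
      (by omega)
    rw [slopeBetween_comm, slopeBetween_comm x v (j + 1)]
    exact this hk hkq hj hjq hne.symm (by rwa [mul_comm]) hP.symm
      (lt_of_le_of_ne (not_lt.1 hlt) hne')
  have u1 := h.first_lt hj hjq
  have u2 := h.first_lt hk hkq
  have hE := le_sideExp hm hp (x j)
  obtain ⟨p, s, hp0, hp1, -, -, -, e, -⟩ := rpow_dividedDifference
    (α := (sideExp lm lp (x j))⁻¹) (a := x (k + 1) - x 1) (b := x (j + 1) - x 1)
    (R := slopeBetween x v (j + 1) (k + 1)) (A := slopeBetween x v (k + 1) 1)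
    (B := slopeBetween x v (j + 1) 1) (by positivity) (inv_le_one_of_one_le₀ hE)
    (by linarith) (by linarith)
    (by
      have : x (j + 1) - x (k + 1) ≠ 0 := by linarith
      have : x (j + 1) - x 1 ≠ 0 := by linarith
      have : x (k + 1) - x 1 ≠ 0 := by linarith
      simp only [slopeBetween]
      field_simp
      ring)
  rw [slope_eq h hv hj hjq hk hkq hjk, abs_mul, abs_of_nonneg hv.nonneg, e]
  set α := (sideExp lm lp (x j))⁻¹
  set R := slopeBetween x v (j + 1) (k + 1)
  set A := slopeBetween x v (k + 1) 1
  have hα : 0 < α := by positivity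
  calc _ ≤ 1 * |α * A + p * (R - A)| := mul_le_mul_of_nonneg_right hv.le_one (abs_nonneg _)
    _ = |p * R - (p - α) * A| := by rw [one_mul]; congr 1; ring
    _ ≤ |p * R| + |(p - α) * A| := abs_sub _ _
    _ = p * |R| + (p - α) * |A| := by
      rw [abs_mul, abs_mul, abs_of_nonneg (hα.le.trans hp0), abs_of_nonneg (sub_nonneg.2 hp0)]
    _ ≤ 1 * |R| + 1 * |A| := by gcongr; linarith
    _ ≤ _ := by linarith [hP.2]

end PullbackEigenvector

namespace PullbackEigenvector

variable {lm lp ρ a M : ℝ} {q : ℕ} {x v : ℕ → ℝ}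

theorem abs_slope_le_run (h : CriticalCycle lm lp q x) (hv : PullbackEigenvector lm lp ρ q x v)
    (ha : 0 < a) (ha1 : a ≤ 1 / 4) (hm : a⁻¹ ≤ lm) (hp : a⁻¹ ≤ lp)
    (hM : ∀ j k, 1 ≤ j → j ≤ q → 1 ≤ k → k ≤ q → |slopeBetween x v j k| ≤ M) (t : ℕ) :
    ∀ j k, 1 ≤ j → j + t < q → 1 ≤ k → k + t < q → j ≠ k → 0 < x j * x k →
      (∀ s < t, 0 < x (j + 1 + s) ∧ 0 < x (k + 1 + s)) →
      |slopeBetween x v j k| ≤ |slopeBetween x v (j + t) (k + t)| + 2 * a * (1 - a ^ t) * M := by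
  have h1a : 1 ≤ a⁻¹ := (one_le_inv₀ ha).2 (by linarith)
  induction t with
  | zero => intro j k _ _ _ _ _ _ _; simp
  | succ t ih =>
    intro j k hj hjq hk hkq hne hjk hs
    have hM0 : 0 ≤ M := (abs_nonneg _).trans (hM j k hj (by omega) hk (by omega))
    have i0 := hs 0 (by omega)
    rw [add_zero, add_zero] at i0
    have i1 := ih (j + 1) (k + 1) (by omega) (by omega) (by omega) (by omega) (by omega)
      (mul_pos i0.1 i0.2) fun s hs' => by
        have := hs (s + 1) (by omega)
        rwa [← add_assoc, ← add_assoc, add_right_comm, add_right_comm (k + 1)] at this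
    have i2 := abs_slope_le_add h hv (h1a.trans hm) (h1a.trans hp) (T := a ^ (t + 1) * M)
      hj (by omega) hk (by omega) hne hjk
      ⟨abs_slope_first_le_pow h hv ha hm hp hM (t + 1) (j + 1) (by omega) (by omega)
        fun s hs' => (hs s hs').1,
      abs_slope_first_le_pow h hv ha hm hp hM (t + 1) (k + 1) (by omega) (by omega)
        fun s hs' => (hs s hs').2⟩
    have e1 : j + 1 + t = j + (t + 1) := by omega
    have e2 : k + 1 + t = k + (t + 1) := by omega
    rw [e1, e2] at i1
    -- The loss at this step is one term of the series `a + a² + ⋯`; since `a ≤ 1/4`, it fits into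
    -- the increment of `2 a (1 - a ^ t)`.
    have : a ^ (t + 1) ≤ 2 * a * (a ^ t - a ^ (t + 1)) := by
      have := pow_pos ha t
      rw [pow_succ]; nlinarith [mul_pos this ha]
    nlinarith [mul_le_mul_of_nonneg_right this hM0]

/-- The rung for separation time `n` is the number of pairs of points of `Λ` separated before `n`.
After the run of positive images, the next image pair is either separated or consists of two
negative points, and in the latter case passing it raises the rung. -/
theorem abs_slope_le_ladder (h : CriticalCycle lm lp q x)
    (hv : PullbackEigenvector lm lp ρ q x v)
    (ha : 0 < a) (ha1 : a ≤ 1 / 4) (hm : a⁻¹ ≤ lm) (hp : a⁻¹ ≤ lp)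
    (hM : ∀ j k, 1 ≤ j → j ≤ q → 1 ≤ k → k ≤ q → |slopeBetween x v j k| ≤ M)
    {g : ℕ → ℝ} (hg0 : 2 * a ≤ g 0) (hag : PowerStep a (g 0)) (hg : Monotone g) {Λ : Finset ℕ}
    (hΛ : ∀ k, 1 ≤ k → k < q → x k < 0 → k ∈ Λ)
    (hgs : ∀ i < Λ.card * Λ.card, PowerStep (2 * g i) (g (i + 1))) (n : ℕ) :
    ∀ j k, 1 ≤ j → j ≤ q → 1 ≤ k → k ≤ q → j ≠ k → separationTime x j k = n →
      |slopeBetween x v j k| ≤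
        2 * g (((Λ ×ˢ Λ).filter fun p => separationTime x p.1 p.2 < n).card) * M := by
  set κ : ℕ → ℕ := fun n => ((Λ ×ˢ Λ).filter fun p => separationTime x p.1 p.2 < n).card with hκ
  have hκmono : Monotone κ := fun m n hmn => Finset.card_le_card fun p hp => by
    simp only [Finset.mem_filter] at hp ⊢
    exact ⟨hp.1, hp.2.trans_le hmn⟩
  have hg0' : ∀ i, 2 * a ≤ g i := fun i => hg0.trans (hg (Nat.zero_le i))
  induction n using Nat.strong_induction_on with
  | _ n ih =>
  intro j k hj hjq hk hkq hne hn
  have hM0 : 0 ≤ M := (abs_nonneg _).trans (hM j k hj hjq hk hkq)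
  rcases le_or_gt (x j * x k) 0 with hjk | hjk
  · refine (abs_slope_le_of_separated hv ha hm hp hM hj hjq hk hkq hjk).trans ?_
    have := hg0' (κ n)
    gcongr
    linarith
  have hjq' : j < q := h.lt_of_ne_zero hjq (left_ne_zero_of_mul hjk.ne')
  have hkq' : k < q := h.lt_of_ne_zero hkq (right_ne_zero_of_mul hjk.ne')
  have hex : ∃ t, ¬ (0 < x (j + 1 + t) ∧ 0 < x (k + 1 + t)) := by
    refine ⟨q - (j + 1), ?_⟩
    rw [Nat.add_sub_cancel' hjq', h.last]
    simp
  classical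
  obtain ⟨t, htn, hts⟩ : ∃ t, ¬ (0 < x (j + 1 + t) ∧ 0 < x (k + 1 + t)) ∧
      ∀ s < t, 0 < x (j + 1 + s) ∧ 0 < x (k + 1 + s) :=
    ⟨Nat.find hex, Nat.find_spec hex, fun s hs => not_not.1 (Nat.find_min hex hs)⟩
  have hpos : ∀ s ≤ t, 0 < x (j + s) * x (k + s) := by
    intro s hs
    rcases s with _ | s
    · simpa using hjk
    · have := hts s (by omega)
      rw [← add_assoc, ← add_assoc, add_right_comm, add_right_comm k]
      exact mul_pos this.1 this.2
  obtain ⟨s1, s2, s3⟩ := h.separationTime_spec hjq hkq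
  rw [hn] at s1 s2 s3
  have htlt : t < n := by
    by_contra! hle
    exact absurd (hpos n hle) (not_lt.2 s1)
  have hrun := abs_slope_le_run h hv ha ha1 hm hp hM t j k hj (by omega) hk (by omega) hne hjk hts
  have hrun' : |slopeBetween x v j k| ≤ |slopeBetween x v (j + t) (k + t)| + 2 * a * M := by
    have : 0 ≤ 2 * a * a ^ t * M := by positivity
    linarith
  -- The run costs `2 a M ≤ g (κ n) M`, which accounts for the factor `2` in the conclusion.
  suffices H : |slopeBetween x v (j + t) (k + t)| ≤ g (κ n) * M by
    have := mul_le_mul_of_nonneg_right (hg0' (κ n)) hM0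
    linarith
  have hb : j + t + 1 ≤ q := by omega
  have hc : k + t + 1 ≤ q := by omega
  have hlife : separationTime x (j + t + 1) (k + t + 1) = n - (t + 1) := by
    rw [add_assoc, add_assoc, h.separationTime_add hjq hkq (by omega), hn]
  have hm' : n - (t + 1) < n := by omega
  have hbsep := (h.separationTime_spec hb hc).1
  have hlt := h.separationTime_first_le hb hc
  rw [hlife] at hbsep hlt
  -- If the image pair is already separated, its slope and one of the slopes to `x 1` are at most `a
  -- M`, and the bottom rung suffices.
  rcases Nat.eq_zero_or_pos (n - (t + 1)) with hz | hz
  · have hbound : ∀ i l, 1 ≤ i → i ≤ q → 1 ≤ l → l ≤ q → separationTime x i l ≤ 0 →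
        |slopeBetween x v i l| ≤ a * M := by
      intro i l hi hiq hl hlq h0
      refine abs_slope_le_of_separated hv ha hm hp hM hi hiq hl hlq ?_
      have := (h.separationTime_spec hiq hlq).1
      rwa [Nat.le_zero.1 h0] at this
    rw [hz] at hlt
    refine (abs_slope_le_step h hv ha hm hp hM hag le_rfl (by omega) (by omega) (by omega)
      (by omega) (by omega) (hpos t le_rfl)
      (hbound _ _ (by omega) hb (by omega) hc (by omega))
      (hlt.imp (hbound _ _ (by omega) hb (by omega) (by omega))
        (hbound _ _ (by omega) hc (by omega) (by omega)))).trans ?_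
    gcongr
    exact hg (Nat.zero_le _)
  · have hprod : 0 < x (j + t + 1) * x (k + t + 1) := by
      have := mul_pos_of_lt_separationTime (x := x) (j := j + t + 1) (k := k + t + 1) (t := 0)
        (by omega)
      simpa using this
    rcases pos_and_pos_or_neg_and_neg_of_mul_pos hprod with ⟨p1, p2⟩ | ⟨p1, p2⟩
    · rw [add_right_comm] at p1
      rw [add_right_comm] at p2
      exact absurd ⟨p1, p2⟩ htn
    have hbΛ := hΛ _ (by omega) (h.lt_of_ne_zero hb p1.ne) p1
    have hcΛ := hΛ _ (by omega) (h.lt_of_ne_zero hc p2.ne) p2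
    -- The image pair itself has separation time exactly `n - (t + 1)`, so it is counted at `n` but
    -- not at `n - (t + 1)`.
    have hκlt : κ (n - (t + 1)) + 1 ≤ κ n := by
      refine Finset.card_lt_card (Finset.ssubset_iff_subset_ne.2 ⟨fun p hp => ?_, fun he => ?_⟩)
      · simp only [Finset.mem_filter] at hp ⊢
        exact ⟨hp.1, hp.2.trans hm'⟩
      · have : (j + t + 1, k + t + 1) ∈
            (Λ ×ˢ Λ).filter fun p => separationTime x p.1 p.2 < n := by
          simp only [Finset.mem_filter, Finset.mem_product]
          exact ⟨⟨hbΛ, hcΛ⟩, by omega⟩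
        rw [← he] at this
        simp only [Finset.mem_filter] at this
        omega
    have hκle : κ n ≤ Λ.card * Λ.card := by
      rw [← Finset.card_product]; exact Finset.card_filter_le _ _
    have hbound : ∀ i, 1 ≤ i → i ≤ q → x i < 0 → separationTime x i 1 ≤ n - (t + 1) →
        i ≠ 1 → |slopeBetween x v i 1| ≤ 2 * g (κ (n - (t + 1))) * M := by
      intro i hi hiq hi0 hle hi1
      refine (ih _ (by omega) i 1 hi hiq le_rfl (by omega) hi1 rfl).trans ?_
      gcongr
      exact hg (hκmono hle)
    refine (abs_slope_le_step h hv ha hm hp hM (hgs (κ (n - (t + 1))) (by omega)) ?_ (by omega)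
      (by omega) (by omega) (by omega) (by omega) (hpos t le_rfl)
      (ih _ hm' _ _ (by omega) hb (by omega) hc (by omega) hlife)
      (hlt.imp (fun hle => hbound _ (by omega) hb p1 hle (by omega))
        (fun hle => hbound _ (by omega) hc p2 hle (by omega)))).trans ?_
    · linarith [hg0' (κ (n - (t + 1)))]
    · gcongr
      exact hg hκlt

end PullbackEigenvector

/-! ### Absence of eigenvalues and positivity of the transversality sum -/

/-- For steep branches the linearised pull-back has no eigenvalue in `[1, ∞)`. -/
theorem exists_forall_pullbackEigenvector_eq_zero (L : ℕ) : ∃ l₀ : ℝ, 1 < l₀ ∧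
    ∀ (lm lp : ℝ) (q : ℕ) (x v : ℕ → ℝ) (ρ : ℝ), l₀ ≤ lm → l₀ ≤ lp →
      CriticalCycle lm lp q x → ((Finset.Ico 1 q).filter fun k => x k < 0).card ≤ L →
      PullbackEigenvector lm lp ρ q x v → v 1 = 0 := by
  obtain ⟨a, g, ha, ha1, hg0, hag, hg, hgs, hgm⟩ := exists_powerStep_ladder (L * L)
  refine ⟨a⁻¹, (one_lt_inv₀ ha).2 (by linarith), ?_⟩
  intro lm lp q x v ρ hm hp h hL hv
  have hq := h.two_le
  obtain ⟨⟨j, k⟩, hjk, hmax⟩ := Finset.exists_max_image (Finset.Icc 1 q ×ˢ Finset.Icc 1 q)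
    (fun p => |slopeBetween x v p.1 p.2|) ⟨(1, 1), by simp; omega⟩
  simp only [Finset.mem_product, Finset.mem_Icc, and_imp, Prod.forall] at hjk hmax
  set M := |slopeBetween x v j k| with hMdef
  have hM0 : 0 ≤ M := abs_nonneg _
  have hLL := Nat.mul_le_mul hL hL
  have hM : M ≤ 0 := by
    by_cases hne : j = k
    · rw [hMdef, hne, slopeBetween, sub_self, zero_div, abs_zero]
    have := hv.abs_slope_le_ladder h ha ha1 hm hp
      (fun j k h1 h2 h3 h4 => hmax j k h1 h2 h3 h4) hg0 hag hg
      (Λ := (Finset.Ico 1 q).filter fun k => x k < 0)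
      (fun k h1 h2 h3 => by simp [h1, h2, h3]) (fun i hi => hgs i (by omega))
      _ j k (by omega) (by omega) (by omega) (by omega) hne rfl
    -- The top rung is at most `1/4`, so the maximal slope satisfies `M ≤ M / 2`.
    refine le_of_mul_le_mul_left (a := 1 / 2) ?_ (by norm_num)
    have h1 : g (((((Finset.Ico 1 q).filter fun k => x k < 0) ×ˢ
        (Finset.Ico 1 q).filter fun k => x k < 0).filter
        fun p => separationTime x p.1 p.2 < separationTime x j k).card) ≤ 1 / 4 := by
      refine (hg ((Finset.card_filter_le _ _).trans ?_)).trans hgm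
      rwa [Finset.card_product]
    have h2 := mul_le_mul_of_nonneg_right h1 hM0
    rw [← hMdef] at this
    linarith
  have h1 := (hmax 1 q le_rfl (by omega) (by omega) le_rfl).trans hM
  have h2 : slopeBetween x v 1 q = 0 := abs_eq_zero.1 (le_antisymm h1 (abs_nonneg _))
  rw [slopeBetween, h.last, hv.last, sub_zero, sub_zero, div_eq_zero_iff] at h2
  exact h2.resolve_right h.first_neg.ne

/-- The derivative of the branches of the family at `y ≠ 0`. -/
noncomputable def branchDeriv (lm lp y : ℝ) : ℝ :=
  sideExp lm lp y * |y| ^ sideExp lm lp y / y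

theorem branchDeriv_ne_zero {lm lp y : ℝ} (hm : 0 < lm) (hp : 0 < lp) (hy : y ≠ 0) :
    branchDeriv lm lp y ≠ 0 := by
  have := sideExp_pos hm hp y
  have := abs_pos.2 hy
  unfold branchDeriv
  positivity

theorem hasDerivAt_asymFamily (lm lp c : ℝ) {y : ℝ} (hy : y ≠ 0) :
    HasDerivAt (asymFamily lm lp c) (branchDeriv lm lp y) y := by
  have key : HasDerivAt (fun z => |z| ^ sideExp lm lp y + c) (branchDeriv lm lp y) y := by
    have h1 := ((hasDerivAt_abs hy).rpow_const (p := sideExp lm lp y)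
      (Or.inl (abs_ne_zero.2 hy))).add_const c
    refine h1.congr_deriv ?_
    rw [branchDeriv, Real.rpow_sub_one (abs_ne_zero.2 hy)]
    rcases hy.lt_or_gt with h | h
    · rw [abs_of_neg h, sign_neg h]; simp; field_simp
    · rw [abs_of_pos h, sign_pos h]; simp; field_simp
  refine key.congr_of_eventuallyEq ?_
  have : ∀ᶠ z in nhds y, 0 < z * y :=
    (continuous_id.mul continuous_const).continuousAt.eventually_const_lt (mul_self_pos.2 hy)
  filter_upwards [this] with z hz
  rw [asymFamily_eq, sideExp_congr hz]

/-- For steep branches, the inverse multipliers along a critical cycle have positive sum. -/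
theorem exists_forall_criticalCycle_sum_pos (L : ℕ) : ∃ l₀ : ℝ, 1 < l₀ ∧
    ∀ (lm lp : ℝ) (q : ℕ) (x : ℕ → ℝ), l₀ ≤ lm → l₀ ≤ lp →
      CriticalCycle lm lp q x → ((Finset.Ico 1 q).filter fun k => x k < 0).card ≤ L →
      0 < ∑ n ∈ Finset.range q, 1 / ∏ i ∈ Finset.range n, branchDeriv lm lp (x (1 + i)) := by
  obtain ⟨l₀, hl₀, H⟩ := exists_forall_pullbackEigenvector_eq_zero L
  refine ⟨l₀, hl₀, fun lm lp q x hm hp h hL => ?_⟩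
  by_contra! hle
  have hq := h.two_le
  set W : ℝ → ℕ → ℝ := fun ρ k => ∑ n ∈ Finset.range (q - k + 1),
    ρ ^ n / ∏ i ∈ Finset.range n, branchDeriv lm lp (x (k + i)) with hW
  have hq1 : q - 1 + 1 = q := by omega
  have hcont : ContinuousOn (fun ρ => W ρ 1) (Set.Icc 0 1) := by
    simp only [hW]; fun_prop
  have h0 : W 0 1 = 1 := by
    simp only [hW]
    rw [Finset.sum_range_succ']
    simp
  have h1 : W 1 1 ≤ 0 := by
    simp only [hW, hq1, one_pow]
    exact hle
  obtain ⟨ρ, ⟨hρ0, hρ1⟩, hρ⟩ := intermediate_value_Icc' zero_le_one hcont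
    ⟨h1, h0.symm ▸ zero_le_one⟩
  dsimp only at hρ
  have hrec : ∀ k, 1 ≤ k → k < q →
      W ρ k = 1 + ρ / branchDeriv lm lp (x k) * W ρ (k + 1) := by
    intro k hk hkq
    simp only [hW]
    rw [Finset.sum_range_succ', Finset.mul_sum, show q - (k + 1) + 1 = q - k by omega, add_comm]
    congr 1
    · simp
    · refine Finset.sum_congr rfl fun n _ => ?_
      rw [Finset.prod_range_succ', pow_succ', add_zero, mul_comm (∏ i ∈ Finset.range n, _),
        mul_div_mul_comm]
      simp only [add_assoc, add_comm 1]
  -- Because `W ρ 1 = 0`, the recursion for `W` turns into the eigenvector equation for `1 - W`,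
  -- whose first entry is `1`.
  have hv : PullbackEigenvector lm lp ρ q x fun k => 1 - W ρ k := by
    refine ⟨hρ0, hρ1, ?_, fun k hk hkq => ?_⟩
    · simp [hW]
    · have hx := h.ne_zero k hk hkq
      have hE := (sideExp_pos h.lm_pos h.lp_pos (x k)).ne'
      have hx' := (Real.rpow_pos_of_pos (abs_pos.2 hx) (sideExp lm lp (x k))).ne'
      rw [hrec k hk hkq, slopeBetween, hρ, h.step k hk hkq, branchDeriv, add_sub_cancel_right]
      field_simp
      ring
  have := H lm lp q x _ ρ hm hp h hL hv
  rw [hρ] at this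
  norm_num at this

/-! ### Derivatives of iterates in the point and in the parameter -/

theorem asymFamily_zero {lm lp : ℝ} (hm : 0 < lm) (c : ℝ) : asymFamily lm lp c 0 = c := by
  simp [asymFamily, Real.zero_rpow hm.ne']

theorem hasDerivAt_iterate_asymFamily {lm lp : ℝ} (hm : 0 < lm) (c : ℝ) (n : ℕ)
    (h : ∀ k, 1 ≤ k → k < n + 1 → (asymFamily lm lp c)^[k] 0 ≠ 0) :
    HasDerivAt (asymFamily lm lp c)^[n]
      (∏ i ∈ Finset.range n, branchDeriv lm lp ((asymFamily lm lp c)^[1 + i] 0)) c := by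
  induction n with
  | zero => simpa using hasDerivAt_id c
  | succ n ih =>
    have hn : (asymFamily lm lp c)^[n] c = (asymFamily lm lp c)^[1 + n] 0 := by
      rw [add_comm 1, Function.iterate_succ_apply, asymFamily_zero hm]
    rw [Function.iterate_succ', Finset.prod_range_succ, mul_comm]
    refine HasDerivAt.comp c ?_ (ih fun k h1 h2 => h k h1 (by omega))
    rw [hn]
    exact hasDerivAt_asymFamily lm lp c (h _ (by omega) (by omega))

theorem hasDerivAt_parameter {lm lp : ℝ} (hm : 0 < lm) (hp : 0 < lp) (c : ℝ) (n : ℕ)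
    (h : ∀ k, 1 ≤ k → k < n + 1 → (asymFamily lm lp c)^[k] 0 ≠ 0) :
    HasDerivAt (fun t => (asymFamily lm lp t)^[n + 1] 0)
      ((∏ i ∈ Finset.range n, branchDeriv lm lp ((asymFamily lm lp c)^[1 + i] 0)) *
        ∑ m ∈ Finset.range (n + 1),
          1 / ∏ i ∈ Finset.range m, branchDeriv lm lp ((asymFamily lm lp c)^[1 + i] 0)) c := by
  induction n with
  | zero =>
    simp only [zero_add, Function.iterate_one, asymFamily_zero hm]
    simpa using hasDerivAt_id' c
  | succ n ih =>
    have hn0 := h (n + 1) (by omega) (by omega)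
    -- The parameter enters additively, so the outermost map can be frozen at `c`.
    have e : (fun t => (asymFamily lm lp t)^[n + 1 + 1] 0) =
        fun t => asymFamily lm lp c ((asymFamily lm lp t)^[n + 1] 0) + (t - c) := by
      funext t
      rw [Function.iterate_succ_apply', asymFamily_eq, asymFamily_eq]
      ring
    rw [e, Finset.sum_range_succ, Finset.prod_range_succ]
    have hne : (∏ i ∈ Finset.range n, branchDeriv lm lp ((asymFamily lm lp c)^[1 + i] 0)) *
        branchDeriv lm lp ((asymFamily lm lp c)^[1 + n] 0) ≠ 0 := by
      rw [← Finset.prod_range_succ]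
      refine Finset.prod_ne_zero_iff.2 fun i hi => branchDeriv_ne_zero hm hp (h _ (by omega) ?_)
      have := Finset.mem_range.1 hi
      omega
    rw [mul_add, mul_one_div_cancel hne, mul_comm (∏ i ∈ Finset.range n, _), mul_assoc]
    refine HasDerivAt.add ?_ ((hasDerivAt_id c).sub_const c)
    have h1 := hasDerivAt_asymFamily lm lp c hn0
    have h2 := ih fun k h1 h2 => h k h1 (by omega)
    rw [add_comm 1 n]
    exact HasDerivAt.comp c h1 h2

theorem criticalCycle_iterate {lm lp c : ℝ} (hm : 0 < lm) (hp : 0 < lp) {q : ℕ} (hq : 2 ≤ q)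
    (h0 : (asymFamily lm lp c)^[q] 0 = 0)
    (h : ∀ k, 1 ≤ k → k < q → (asymFamily lm lp c)^[k] 0 ≠ 0) :
    CriticalCycle lm lp q fun k => (asymFamily lm lp c)^[k] 0 := by
  refine ⟨hm, hp, hq, h0, h, fun k _ _ => ?_⟩
  rw [Function.iterate_succ_apply', asymFamily_eq, Function.iterate_one, asymFamily_zero hm]

/-! ### Pull-backs of the turning point as functions of the parameter -/

/-- The `m`-fold pull-back of `0` by the parameter-`c` map along the branches prescribed by `ε`. -/
noncomputable def criticalPullback (lm lp : ℝ) (ε : ℕ → SignType) : ℕ → ℝ → ℝ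
  | 0, _ => 0
  | m + 1, c => (ε m : ℝ) *
      (criticalPullback lm lp ε m c - c) ^ (sideExp lm lp (ε m : ℝ))⁻¹

/-- The parameters at which the first `m` pull-backs of `0` exist. -/
def pullbackDomain (lm lp : ℝ) (ε : ℕ → SignType) (m : ℕ) : Set ℝ :=
  {c | ∀ j < m, 0 < criticalPullback lm lp ε j c - c}

section pullback

variable {lm lp : ℝ} {ε : ℕ → SignType}

theorem pullbackDomain_succ (m : ℕ) : pullbackDomain lm lp ε (m + 1) =
    pullbackDomain lm lp ε m ∩ {c | 0 < criticalPullback lm lp ε m c - c} := by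
  ext c
  simp only [pullbackDomain, Set.mem_ofPred_eq, Set.mem_inter_iff, Nat.forall_lt_succ_right]

theorem criticalPullback_succ_mul_pos {m : ℕ} {c : ℝ} (hε : ε m ≠ 0)
    (hc : 0 < criticalPullback lm lp ε m c - c) :
    0 < criticalPullback lm lp ε (m + 1) c * (ε m : ℝ) := by
  have := Real.rpow_pos_of_pos hc (sideExp lm lp (ε m : ℝ))⁻¹
  rw [criticalPullback]
  cases h : ε m <;> simp_all

theorem abs_criticalPullback_succ (hm : 0 < lm) (hp : 0 < lp) {m : ℕ} {c : ℝ} (hε : ε m ≠ 0)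
    (hc : 0 < criticalPullback lm lp ε m c - c) :
    |criticalPullback lm lp ε (m + 1) c| ^ sideExp lm lp (criticalPullback lm lp ε (m + 1) c) =
      criticalPullback lm lp ε m c - c := by
  rw [sideExp_congr (criticalPullback_succ_mul_pos hε hc), criticalPullback, abs_mul,
    abs_of_pos (Real.rpow_pos_of_pos hc _)]
  have h1 : |(ε m : ℝ)| = 1 := by cases h : ε m <;> simp_all
  rw [h1, one_mul, Real.rpow_inv_rpow hc.le (sideExp_pos hm hp _).ne']

theorem asymFamily_criticalPullback_succ (hm : 0 < lm) (hp : 0 < lp) {m : ℕ} {c : ℝ}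
    (hε : ε m ≠ 0) (hc : 0 < criticalPullback lm lp ε m c - c) :
    asymFamily lm lp c (criticalPullback lm lp ε (m + 1) c) = criticalPullback lm lp ε m c := by
  rw [asymFamily_eq, abs_criticalPullback_succ hm hp hε hc, sub_add_cancel]

/-- Differentiating `f_c (y (m+1)) = y m` gives `y (m+1)' = (y m' - 1) / Df(y (m+1))`; the sum
solves this recursion. Hence `y m - c` has derivative minus the sum, which at a fixed parameter is
the transversality sum. -/
theorem hasDerivAt_criticalPullback (hm : 0 < lm) (hp : 0 < lp) (m : ℕ) (hε : ∀ j < m, ε j ≠ 0)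
    {c : ℝ} (hc : c ∈ pullbackDomain lm lp ε m) :
    HasDerivAt (criticalPullback lm lp ε m)
      (1 - ∑ n ∈ Finset.range (m + 1),
        1 / ∏ i ∈ Finset.range n, branchDeriv lm lp (criticalPullback lm lp ε (m - i) c)) c := by
  induction m with
  | zero =>
    have e : criticalPullback lm lp ε 0 = fun _ => 0 := by funext c; rw [criticalPullback]
    rw [e]
    simpa using hasDerivAt_const c (0 : ℝ)
  | succ m ih =>
    rw [pullbackDomain_succ] at hc
    obtain ⟨hc1, hc2⟩ := hc
    rw [Set.mem_ofPred_eq] at hc2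
    have h1 := ih (fun j hj => hε j (by omega)) hc1
    have hεm := hε m (by omega)
    have e : criticalPullback lm lp ε (m + 1) = fun c => (ε m : ℝ) *
      (criticalPullback lm lp ε m c - c) ^ (sideExp lm lp (ε m : ℝ))⁻¹ := by
      funext c; rw [criticalPullback]
    have h2 : HasDerivAt (fun c => (ε m : ℝ) *
        (criticalPullback lm lp ε m c - c) ^ (sideExp lm lp (ε m : ℝ))⁻¹) _ c :=
      ((h1.sub (hasDerivAt_id' c)).rpow_const (p := (sideExp lm lp (ε m : ℝ))⁻¹)
        (Or.inl hc2.ne')).const_mul (ε m : ℝ)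
    rw [← e] at h2
    have hs := criticalPullback_succ_mul_pos hεm hc2
    have hne : criticalPullback lm lp ε (m + 1) c ≠ 0 := left_ne_zero_of_mul hs.ne'
    rw [Finset.sum_range_succ']
    simp only [Finset.prod_range_succ', Nat.add_sub_add_right, Nat.sub_zero,
      Finset.prod_range_zero, div_one]
    refine h2.congr_deriv ?_
    have hd : branchDeriv lm lp (criticalPullback lm lp ε (m + 1) c) =
        sideExp lm lp (ε m : ℝ) * (criticalPullback lm lp ε m c - c) /
          criticalPullback lm lp ε (m + 1) c := by
      rw [branchDeriv, abs_criticalPullback_succ hm hp hεm hc2, sideExp_congr hs]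
    have hE := (sideExp_pos hm hp (ε m : ℝ)).ne'
    simp only [one_div, mul_inv]
    rw [← Finset.sum_mul, hd, Pi.sub_apply, Real.rpow_sub_one hc2.ne', inv_div,
      show criticalPullback lm lp ε (m + 1) c = (ε m : ℝ) *
        (criticalPullback lm lp ε m c - c) ^ (sideExp lm lp (ε m : ℝ))⁻¹ by rw [criticalPullback]]
    field_simp
    ring

/-- At a parameter of the domain that equals its own pull-back, the critical orbit is periodic. -/
theorem iterate_eq_criticalPullback (hm : 0 < lm) (hp : 0 < lp) {m : ℕ} (hε : ∀ j < m, ε j ≠ 0)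
    {c : ℝ} (hc : c ∈ pullbackDomain lm lp ε m) (h0 : criticalPullback lm lp ε m c = c) :
    ∀ i ≤ m, (asymFamily lm lp c)^[1 + i] 0 = criticalPullback lm lp ε (m - i) c := by
  intro i
  induction i with
  | zero => intro _; simp [asymFamily_zero hm, h0]
  | succ i ih =>
    intro hi
    rw [← add_assoc, Function.iterate_succ_apply', ih (by omega),
      show m - i = m - (i + 1) + 1 by omega]
    exact asymFamily_criticalPullback_succ hm hp (hε _ (by omega)) (hc _ (by omega))

end pullback

/-! ### Uniqueness of the parameter -/

/-- If `g a ≤ 0`, then `g` cannot rise above `0` on `[a, b]`, as every zero is crossed downwards.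
Hence `g b = 0`, but the negative derivative there makes `g` positive just to the left of `b`. -/
theorem pos_of_deriv_neg_at_zeros {D : Set ℝ} (hD : D.OrdConnected) {g g' : ℝ → ℝ}
    (hg : ∀ c ∈ D, HasDerivAt g (g' c) c) (hneg : ∀ c ∈ D, g c = 0 → g' c < 0) {a b : ℝ}
    (ha : a ∈ D) (hb : b ∈ D) (hab : a < b) (hgb : 0 ≤ g b) : 0 < g a := by
  by_contra! hle
  have hsub := hD.out ha hb
  have key : ∀ ⦃x⦄, x ∈ Set.Icc a b → g x ≤ 0 :=
    image_le_of_deriv_right_lt_deriv_boundary' (f := g) (f' := g') (B := fun _ => 0)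
      (B' := fun _ => 0)
      (fun x hx => (hg x (hsub hx)).continuousAt.continuousWithinAt)
      (fun x hx => (hg x (hsub ⟨hx.1, hx.2.le⟩)).hasDerivWithinAt) hle continuousOn_const
      (fun x _ => hasDerivWithinAt_const _ _ _)
      (fun x hx h => hneg x (hsub ⟨hx.1, hx.2.le⟩) h)
  have hgb0 : g b = 0 := le_antisymm (key ⟨hab.le, le_rfl⟩) hgb
  have h1 := (hasDerivAt_iff_tendsto_slope.1 (hg b hb)).eventually_lt_const (hneg b hb hgb0)
  have h2 := h1.filter_mono (nhdsWithin_mono b (show Set.Iio b ⊆ {b}ᶜ from fun x hx => hx.ne))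
  obtain ⟨x, hx1, hx2⟩ := (h2.and (Ioo_mem_nhdsLT hab)).exists
  have h3 := key ⟨hx2.1.le, hx2.2.le⟩
  rw [slope_def_field, hgb0, sub_zero] at hx1
  exact absurd hx1 (not_lt.2 (div_nonneg_of_nonpos h3 (by linarith [hx2.2])))

section uniqueness

variable {lm lp : ℝ} {ε : ℕ → SignType} {L : ℕ}

theorem sum_pos_of_criticalPullback_eq (hm : 0 < lm) (hp : 0 < lp)
    (H : ∀ (q : ℕ) (x : ℕ → ℝ), CriticalCycle lm lp q x →
      ((Finset.Ico 1 q).filter fun k => x k < 0).card ≤ L →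
      0 < ∑ n ∈ Finset.range q, 1 / ∏ i ∈ Finset.range n, branchDeriv lm lp (x (1 + i)))
    {m : ℕ} (hε : ∀ j < m, ε j ≠ 0)
    (hL : ((Finset.range m).filter fun j => ε j = -1).card ≤ L) {c : ℝ}
    (hc : c ∈ pullbackDomain lm lp ε m) (h0 : criticalPullback lm lp ε m c = c) :
    0 < ∑ n ∈ Finset.range (m + 1),
      1 / ∏ i ∈ Finset.range n, branchDeriv lm lp (criticalPullback lm lp ε (m - i) c) := by
  rcases Nat.eq_zero_or_pos m with rfl | hm0
  · simp
  have hx := iterate_eq_criticalPullback hm hp hε hc h0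
  have hsgn : ∀ k, 1 ≤ k → k < m + 1 →
      0 < (asymFamily lm lp c)^[k] 0 * (ε (m - k) : ℝ) := by
    intro k h1 hk
    obtain ⟨k, rfl⟩ : ∃ n, k = 1 + n := ⟨k - 1, by omega⟩
    rw [hx k (by omega), show m - k = m - (1 + k) + 1 by omega]
    exact criticalPullback_succ_mul_pos (hε _ (by omega)) (hc _ (by omega))
  have hq : (asymFamily lm lp c)^[m + 1] 0 = 0 := by
    rw [add_comm, hx m le_rfl, Nat.sub_self, criticalPullback]
  have hcyc := criticalCycle_iterate hm hp (q := m + 1) (by omega) hq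
    fun k h1 hk => left_ne_zero_of_mul (hsgn k h1 hk).ne'
  refine (H _ _ hcyc (le_trans ?_ hL)).trans_eq ?_
  -- Pull-backs run against orbit time: the sign of the `k`-th iterate is the symbol `ε (m - k)`.
  · refine Finset.card_le_card_of_injOn (fun k => m - k) ?_ ?_
    · intro k hk
      simp only [Finset.coe_filter, Finset.mem_Ico, Set.mem_ofPred_eq, Finset.mem_range] at hk ⊢
      refine ⟨by omega, ?_⟩
      have := hsgn k hk.1.1 hk.1.2
      have h2 : (ε (m - k) : ℝ) < 0 := by
        by_contra! h3
        exact absurd this (not_lt.2 (mul_nonpos_of_nonpos_of_nonneg hk.2.le h3))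
      cases h : ε (m - k) <;> simp_all
      linarith
    · intro k hk l hl hkl
      simp only [Finset.coe_filter, Finset.mem_Ico, Set.mem_ofPred_eq] at hk hl hkl
      omega
  · refine Finset.sum_congr rfl fun n hn => ?_
    congr 1
    refine Finset.prod_congr rfl fun i hi => ?_
    rw [Finset.mem_range] at hn hi
    rw [hx i (by omega)]

theorem card_filter_range_mono {ε : ℕ → SignType} {m N : ℕ} (hmN : m ≤ N)
    (hL : ((Finset.range N).filter fun j => ε j = -1).card ≤ L) :
    ((Finset.range m).filter fun j => ε j = -1).card ≤ L :=
  (Finset.card_le_card (Finset.filter_subset_filter _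
    (Finset.range_subset_range.2 hmN))).trans hL

theorem pos_of_criticalPullback (hm : 0 < lm) (hp : 0 < lp)
    (H : ∀ (q : ℕ) (x : ℕ → ℝ), CriticalCycle lm lp q x →
      ((Finset.Ico 1 q).filter fun k => x k < 0).card ≤ L →
      0 < ∑ n ∈ Finset.range q, 1 / ∏ i ∈ Finset.range n, branchDeriv lm lp (x (1 + i)))
    {m : ℕ} (hε : ∀ j < m, ε j ≠ 0)
    (hL : ((Finset.range m).filter fun j => ε j = -1).card ≤ L)
    (hD : (pullbackDomain lm lp ε m).OrdConnected) {a b : ℝ} (ha : a ∈ pullbackDomain lm lp ε m)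
    (hb : b ∈ pullbackDomain lm lp ε m) (hab : a < b)
    (hgb : 0 ≤ criticalPullback lm lp ε m b - b) : 0 < criticalPullback lm lp ε m a - a := by
  refine pos_of_deriv_neg_at_zeros (g := fun c => criticalPullback lm lp ε m c - c) hD
    (fun c hc => (hasDerivAt_criticalPullback hm hp m hε hc).sub (hasDerivAt_id' c))
    (fun c hc h0 => ?_) ha hb hab hgb
  have := sum_pos_of_criticalPullback_eq hm hp H hε hL hc (sub_eq_zero.1 h0)
  linarith

/-- Each new condition `0 < criticalPullback m c - c` is inherited to the left within the previous
interval, so it cuts out an interval again. Transversality is therefore needed for all the shorter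
cycles too, whose negative symbols are still at most `L`. -/
theorem ordConnected_pullbackDomain (hm : 0 < lm) (hp : 0 < lp)
    (H : ∀ (q : ℕ) (x : ℕ → ℝ), CriticalCycle lm lp q x →
      ((Finset.Ico 1 q).filter fun k => x k < 0).card ≤ L →
      0 < ∑ n ∈ Finset.range q, 1 / ∏ i ∈ Finset.range n, branchDeriv lm lp (x (1 + i)))
    {N : ℕ} (hε : ∀ j < N, ε j ≠ 0)
    (hL : ((Finset.range N).filter fun j => ε j = -1).card ≤ L) (m : ℕ) (hmN : m ≤ N) :
    (pullbackDomain lm lp ε m).OrdConnected := by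
  induction m with
  | zero => simp only [pullbackDomain, not_lt_zero, false_imp_iff, implies_true]
            exact Set.ordConnected_univ
  | succ m ih =>
    have hD := ih (by omega)
    rw [pullbackDomain_succ]
    refine ⟨fun a ha b hb t ht => ⟨hD.out ha.1 hb.1 ht, ?_⟩⟩
    rcases ht.2.eq_or_lt with rfl | htb
    · exact hb.2
    · exact pos_of_criticalPullback hm hp H (fun j hj => hε j (by omega))
        (card_filter_range_mono (by omega) hL) hD (hD.out ha.1 hb.1 ht) hb.1 htb (le_of_lt hb.2)

theorem criticalPullback_eq_unique (hm : 0 < lm) (hp : 0 < lp)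
    (H : ∀ (q : ℕ) (x : ℕ → ℝ), CriticalCycle lm lp q x →
      ((Finset.Ico 1 q).filter fun k => x k < 0).card ≤ L →
      0 < ∑ n ∈ Finset.range q, 1 / ∏ i ∈ Finset.range n, branchDeriv lm lp (x (1 + i)))
    {N : ℕ} (hε : ∀ j < N, ε j ≠ 0)
    (hL : ((Finset.range N).filter fun j => ε j = -1).card ≤ L) {a b : ℝ}
    (ha : a ∈ pullbackDomain lm lp ε N) (hb : b ∈ pullbackDomain lm lp ε N)
    (ha0 : criticalPullback lm lp ε N a = a) (hb0 : criticalPullback lm lp ε N b = b) : a = b := by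
  have hD := ordConnected_pullbackDomain hm hp H hε hL N le_rfl
  rcases lt_trichotomy a b with hab | hab | hab
  · have := pos_of_criticalPullback hm hp H hε hL hD ha hb hab (by linarith)
    linarith
  · exact hab
  · have := pos_of_criticalPullback hm hp H hε hL hD hb ha hab (by linarith)
    linarith

/-- The `m`-th pull-back along the true signs retraces the orbit backwards and equals the iterate of
order `N + 1 - m`; for `m = N` this is `c`. -/
theorem criticalPullback_of_sign (hm : 0 < lm) (hp : 0 < lp) {N : ℕ} {c : ℝ} {s : ℕ → SignType}
    (hs : ∀ k, 1 ≤ k → k ≤ N → SignType.sign ((asymFamily lm lp c)^[k] 0) = s k)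
    (hs0 : ∀ k, 1 ≤ k → k ≤ N → s k ≠ 0) (h0 : (asymFamily lm lp c)^[N + 1] 0 = 0) :
    c ∈ pullbackDomain lm lp (fun m => s (N - m)) N ∧
      criticalPullback lm lp (fun m => s (N - m)) N c = c := by
  have hne : ∀ k, 1 ≤ k → k ≤ N → (asymFamily lm lp c)^[k] 0 ≠ 0 := fun k h1 hk =>
    sign_ne_zero.1 (hs k h1 hk ▸ hs0 k h1 hk)
  have hstep : ∀ m < N, (asymFamily lm lp c)^[N + 1 - m] 0 - c =
      |(asymFamily lm lp c)^[N - m] 0| ^ sideExp lm lp ((asymFamily lm lp c)^[N - m] 0) := by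
    intro m hmN
    rw [show N + 1 - m = N - m + 1 by omega, Function.iterate_succ_apply', asymFamily_eq,
      add_sub_cancel_right]
  have key : ∀ m ≤ N, criticalPullback lm lp (fun m => s (N - m)) m c =
      (asymFamily lm lp c)^[N + 1 - m] 0 := by
    intro m
    induction m with
    | zero => intro _; rw [criticalPullback, Nat.sub_zero, h0]
    | succ m ih =>
      intro hmN
      rw [criticalPullback, ih (by omega), hstep m (by omega), ← hs (N - m) (by omega) (by omega),
        Nat.add_sub_add_right]
      set y := (asymFamily lm lp c)^[N - m] 0 with hy
      have hy0 : y ≠ 0 := hne _ (by omega) (by omega)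
      have e : sideExp lm lp (SignType.sign y : ℝ) = sideExp lm lp y :=
        sideExp_congr (by rw [sign_mul_self]; exact abs_pos.2 hy0)
      rw [e, Real.rpow_rpow_inv (abs_nonneg _) (sideExp_pos hm hp y).ne', sign_mul_abs]
  refine ⟨fun m hmN => ?_, ?_⟩
  · rw [key m hmN.le, hstep m hmN]
    exact Real.rpow_pos_of_pos (abs_pos.2 (hne _ (by omega) (by omega))) _
  · rw [key N le_rfl, Nat.add_sub_cancel_left, Function.iterate_one, asymFamily_zero hm]

end uniqueness

/-! ### The main theorem -/

theorem mainTheorem8 (L : ℕ) (hL : 1 ≤ L) :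
    ∃ l₀ : ℝ, 1 < l₀ ∧
      ∀ (q : ℕ+) (i : ℕ+ → SignType),
        Function.Periodic i q →
        (∃ k, i k = 0) →
        ((Finset.Ico 1 q).filter (fun j => i j = -1)).card ≤ L →
        ∀ lm lp : ℝ, l₀ ≤ lm → l₀ ≤ lp →
          -- at most one parameter realises `i`
          {c : ℝ | kneadingSeq (asymFamily lm lp c) = i}.Subsingleton ∧
          -- positive transversality at a parameter realising `i`, `q` being the minimal period
          ((∀ p : ℕ+, p < q → ¬ Function.Periodic i p) →
            ∀ c : ℝ, kneadingSeq (asymFamily lm lp c) = i →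
              (∀ n < (q : ℕ), deriv ((asymFamily lm lp c)^[n]) c ≠ 0) ∧
              0 < ∑ n ∈ Finset.range (q : ℕ), 1 / deriv ((asymFamily lm lp c)^[n]) c ∧
              0 < deriv (fun t : ℝ => (asymFamily lm lp t)^[(q : ℕ)] 0) c /
                    deriv ((asymFamily lm lp c)^[(q : ℕ) - 1]) c) := by
  obtain ⟨l₀, hl₀, H⟩ := exists_forall_criticalCycle_sum_pos L
  refine ⟨l₀, hl₀, fun q i hper hzero hcard lm lp hlm hlp => ?_⟩
  have hm : 0 < lm := by linarith
  have hp : 0 < lp := by linarith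
  have H' := fun q x => H lm lp q x hlm hlp
  -- `q` is any period here, so the argument uses the first zero symbol `p ≤ q` instead; this only
  -- lowers the number of negative symbols.
  obtain ⟨p, hp0, hpmin⟩ : ∃ p : ℕ+, i p = 0 ∧ ∀ k < p, i k ≠ 0 := by
    classical
    exact ⟨PNat.find hzero, PNat.find_spec hzero, fun k hk => PNat.find_min hzero hk⟩
  have hpq : p ≤ q := by
    by_contra! hlt
    have hlt' : p - q < p := by
      rw [← PNat.coe_lt_coe, PNat.sub_coe, if_pos hlt]
      have := q.pos
      have := p.pos
      omega
    refine hpmin (p - q) hlt' ?_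
    rw [← hp0, ← hper (p - q), PNat.sub_add_of_lt hlt]
  obtain ⟨N, hN⟩ : ∃ N, (p : ℕ) = N + 1 := ⟨p - 1, by have := p.pos; omega⟩
  set s : ℕ → SignType := fun k => i k.toPNat' with hs
  have hsign : ∀ c, kneadingSeq (asymFamily lm lp c) = i → ∀ k, 1 ≤ k →
      SignType.sign ((asymFamily lm lp c)^[k] 0) = s k := by
    intro c hc k hk
    simp only [hs, ← hc, kneadingSeq]
    rw [Nat.toPNat'_coe, if_pos (by omega)]
  have hs0 : ∀ k, 1 ≤ k → k ≤ N → s k ≠ 0 := by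
    intro k h1 hk
    refine hpmin _ ?_
    rw [← PNat.coe_lt_coe, Nat.toPNat'_coe, if_pos (by omega)]
    omega
  have hsp : s (N + 1) = 0 := by
    simp only [hs]
    rw [← hN, PNat.coe_toPNat', hp0]
  have hit0 : ∀ c, kneadingSeq (asymFamily lm lp c) = i → (asymFamily lm lp c)^[N + 1] 0 = 0 :=
    fun c hc => sign_eq_zero_iff.1 ((hsign c hc _ (by omega)).trans hsp)
  have hcount : ((Finset.Ico 1 (N + 1)).filter fun k => s k = -1).card ≤ L := by
    refine le_trans (Finset.card_le_card_of_injOn Nat.toPNat' ?_ ?_) hcard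
    · intro k hk
      simp only [Finset.coe_filter, Finset.mem_Ico, Set.mem_ofPred_eq] at hk ⊢
      refine ⟨⟨one_le, lt_of_lt_of_le ?_ hpq⟩, hk.2⟩
      rw [← PNat.coe_lt_coe, Nat.toPNat'_coe, if_pos (by omega)]
      omega
    · intro k hk l hl hkl
      simp only [Finset.coe_filter, Finset.mem_Ico, Set.mem_ofPred_eq] at hk hl
      have := congrArg PNat.val hkl
      simpa [Nat.toPNat'_coe, show 0 < k by omega, show 0 < l by omega] using this
  refine ⟨?_, fun hminper c hc => ?_⟩
  · intro c hc c' hc'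
    obtain ⟨h1, h2⟩ := criticalPullback_of_sign hm hp (fun k h1 _ => hsign c hc k h1) hs0
      (hit0 c hc)
    obtain ⟨h3, h4⟩ := criticalPullback_of_sign hm hp (fun k h1 _ => hsign c' hc' k h1) hs0
      (hit0 c' hc')
    refine criticalPullback_eq_unique hm hp H' (fun j hj => hs0 _ (by omega) (by omega))
      (le_trans (Finset.card_le_card_of_injOn (fun j => N - j) ?_ ?_) hcount) h1 h3 h2 h4
    · intro k hk
      simp only [Finset.coe_filter, Finset.mem_Ico, Set.mem_ofPred_eq, Finset.mem_range] at hk ⊢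
      exact ⟨by omega, hk.2⟩
    · intro k hk l hl hkl
      simp only [Finset.coe_filter, Finset.mem_range, Set.mem_ofPred_eq] at hk hl hkl
      omega
  · have h0 := hit0 c hc
    -- Once the critical orbit returns to `0` at time `p`, the kneading sequence has period `p`, so
    -- a minimal `q` equals `p`.
    have hqp : q = p := by
      refine le_antisymm (not_lt.1 fun hlt => hminper p hlt fun k => ?_) hpq
      rw [← hc]
      simp only [kneadingSeq]
      rw [PNat.add_coe, Function.iterate_add_apply, hN, h0]
    have hqN : (q : ℕ) = N + 1 := by rw [hqp, hN]
    have hne : ∀ k, 1 ≤ k → k < N + 1 → (asymFamily lm lp c)^[k] 0 ≠ 0 := fun k h1 hk =>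
      sign_ne_zero.1 (hsign c hc k h1 ▸ hs0 k h1 (by omega))
    have hd : ∀ n < N + 1, deriv ((asymFamily lm lp c)^[n]) c =
        ∏ i ∈ Finset.range n, branchDeriv lm lp ((asymFamily lm lp c)^[1 + i] 0) := fun n hn =>
      (hasDerivAt_iterate_asymFamily hm c n fun k h1 hk => hne k h1 (by omega)).deriv
    have hd0 : ∀ n < N + 1,
        ∏ i ∈ Finset.range n, branchDeriv lm lp ((asymFamily lm lp c)^[1 + i] 0) ≠ 0 := by
      refine fun n hn => Finset.prod_ne_zero_iff.2 fun i hi =>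
        branchDeriv_ne_zero hm hp (hne _ (by omega) ?_)
      have := Finset.mem_range.1 hi
      omega
    have hsum : 0 < ∑ n ∈ Finset.range (N + 1),
        1 / ∏ i ∈ Finset.range n, branchDeriv lm lp ((asymFamily lm lp c)^[1 + i] 0) := by
      -- For `N = 0` the turning point is fixed and the sum is `1`; `CriticalCycle` requires length
      -- at least two.
      rcases Nat.eq_zero_or_pos N with rfl | hN0
      · simp
      refine H' (N + 1) (fun k => (asymFamily lm lp c)^[k] 0)
        (criticalCycle_iterate hm hp (by omega) h0 hne) (le_trans (Finset.card_le_card ?_) hcount)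
      intro k hk
      simp only [Finset.mem_filter, Finset.mem_Ico] at hk ⊢
      refine ⟨hk.1, ?_⟩
      rw [← hsign c hc k hk.1.1]
      exact sign_neg hk.2
    rw [hqN]
    refine ⟨fun n hn => by rw [hd n hn]; exact hd0 n hn, ?_, ?_⟩
    · refine hsum.trans_eq (Finset.sum_congr rfl fun n hn => ?_)
      rw [hd n (Finset.mem_range.1 hn)]
    · rw [Nat.add_sub_cancel, hd N (by omega), (hasDerivAt_parameter hm hp c N hne).deriv,
        mul_div_cancel_left₀ _ (hd0 N (by omega))]
      exact hsum
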